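/- **Setting.** For $q\in\mathbb N$ let $\mathcal A_q$ be the set of even, compactly supported, smooth functions $\varphi:\mathbb R\to\mathbb C$ that are constant near $0$ and satisfy $\int_0^\infty\varphi(x)\,dx=\tfrac12$ and $\int_0^\infty x^{j/m}\varphi(x)\,dx=0$ for $1\le j,m\le q$. For $\varepsilon>0$ put $\varphi_\varepsilon(x)=\varepsilon^{-1}\varphi(x/\varepsilon)$. Let $\Gamma$ be the set of strictly increasing sequences $\gamma:\mathbb N\to[0,\infty)$ with $\gamma(q)\to\infty$. For a map $x:\mathcal A_0\to\mathbb C$, call $x$ *moderate* if there is $N\in\mathbb N$ such that for every $\varphi\in\mathcal A_N$ there are $c>0$, $\eta\in(0,1]$ with $|x(\varphi_\varepsilon)|\le c\,\varepsilon^{-N}$ for all $0<\varepsilon<\eta$. Call it *null* if there are $N\in\mathbb N$ and $\gamma\in\Gamma$ such that for all $q\ge N$ and $\varphi\in\mathcal A_q$ there are $c>0$, $\eta\in(0,1]$ with $|x(\varphi_\varepsilon)|\le c\,\varepsilon^{\gamma(q)-N}$ for all $0<\varepsilon<\eta$. The ring $\overline{\mathbb K}$ of Colombeau's full generalized complex numbers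 is the ring of moderate maps modulo the ideal of null moderate maps. For an open set $\Omega\subseteq\mathbb C^n$, consider the families $(u_\varphi)_{\varphi\in\mathcal A_0}$ of smooth functions $u_\varphi:\Omega\to\mathbb C$ (smooth in the $2n$ real coordinates). Such a family is *moderate* (respectively *null*) if for every compact $K\subset\Omega$ and every real partial derivative $\partial^\alpha$ the quantities $\sup_{x\in K}|\partial^\alpha u_{\varphi_\varepsilon}(x)|$ satisfy the moderate (respectively null) estimate above, with $N$ (respectively $N,\gamma$) depending on $K$ and $\alpha$. The algebra $\mathcal G(\Omega)$ of Colombeau's full generalized functions is the ring of moderate families modulo the ideal of null moderate families. It is a $\overline{\mathbb K}$-algebra, generalized numbers acting as constants. The derivatives $\frac{\partial}{\partial z_k}=\frac12\bigl(\frac{\partial}{\partial x_k}-i\frac{\partial}{\partial y_k}\bigr)$ act on $\mathcal G(\Omega)$ through representatives. A smooth function $f$ on $\Omega$ is identified with the class of the family constantly equal to $f$. **Theorem.** Let $\Omega\subseteq\mathbb C^n$ be a connected (non-empty) open set, let $f$ be a non-constant holomorphic function on $\Omega$, let $m\le n$, and let $L=\sum_{1\le k\le m}a_k\frac{\partial}{\partial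 z_k}$ with coefficients $a_1,\dots,a_m\in\overline{\mathbb K}$. Let $\mathfrak J$ be the ideal of $\overline{\mathbb K}$ generated by $\{a_1,\dots,a_m\}$. If there exists $u\in\mathcal G(\Omega)$ with $L(u)=f$ in $\mathcal G(\Omega)$, then $\mathfrak J=\overline{\mathbb K}$. -/

import Mathlib

open MeasureTheory Set Filter Topology TopologicalSpace
open scoped ContDiff

namespace ColombeauFull

/-! ### Mollifiers -/

/-- `moll q` is the set of mollifiers of order `q`: the even complex-valued test functions on the
line that are constant near the origin, satisfy `∫₀^∞ φ = 1/2`, and whose moments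
`∫₀^∞ x ^ (j / m) φ(x) dx` vanish for all `1 ≤ j, m ≤ q`. -/
def moll (q : ℕ) : Set (ℝ → ℂ) :=
  {φ | ContDiff ℝ ∞ φ ∧ HasCompactSupport φ ∧ (∀ x, φ (-x) = φ x) ∧
    (∃ c : ℂ, ∀ᶠ x in 𝓝 (0 : ℝ), φ x = c) ∧
    (∫ x in Ioi (0 : ℝ), φ x) = 1 / 2 ∧
    ∀ j m : ℕ, 1 ≤ j → j ≤ q → 1 ≤ m → m ≤ q →
      (∫ x in Ioi (0 : ℝ), ((x ^ ((j : ℝ) / (m : ℝ)) : ℝ) : ℂ) * φ x) = 0}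

theorem moll_anti {p q : ℕ} (h : p ≤ q) : moll q ⊆ moll p := fun _ hφ =>
  ⟨hφ.1, hφ.2.1, hφ.2.2.1, hφ.2.2.2.1, hφ.2.2.2.2.1, fun j m h1 h2 h3 h4 =>
    hφ.2.2.2.2.2 j m h1 (h2.trans h) h3 (h4.trans h)⟩

/-- The rescaled function `x ↦ ε⁻¹ φ(x / ε)`. -/
noncomputable def rescale (ε : ℝ) (φ : ℝ → ℂ) : ℝ → ℂ := fun x => ((ε⁻¹ : ℝ) : ℂ) * φ (ε⁻¹ * x)

theorem rescale_mem {q : ℕ} {ε : ℝ} (hε : 0 < ε) {φ : ℝ → ℂ} (hφ : φ ∈ moll q) :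
    rescale ε φ ∈ moll q := by
  obtain ⟨h1, h2, h3, ⟨c, h4⟩, h5, h6⟩ := hφ
  have hi : 0 < ε⁻¹ := inv_pos.2 hε
  refine ⟨?_, ?_, ?_, ⟨((ε⁻¹ : ℝ) : ℂ) * c, ?_⟩, ?_, ?_⟩
  · exact contDiff_const.mul (h1.comp (contDiff_const.mul contDiff_id))
  · have := h2.comp_homeomorph (Homeomorph.mulLeft₀ ε⁻¹ hi.ne')
    exact this.mul_left
  · intro x
    simp [rescale, h3]
  · have : Tendsto (fun x : ℝ => ε⁻¹ * x) (𝓝 0) (𝓝 0) := by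
      have h : Continuous fun x : ℝ => ε⁻¹ * x := by fun_prop
      simpa using h.tendsto 0
    filter_upwards [this.eventually h4] with x hx
    simp [rescale, hx]
  · have := integral_comp_mul_left_Ioi φ 0 hi
    simp only [rescale]
    rw [MeasureTheory.integral_const_mul, this]
    simp only [mul_zero, h5, inv_inv, Complex.real_smul]
    push_cast
    have : (ε : ℂ) ≠ 0 := by exact_mod_cast hε.ne'
    field_simp
  · intro j m hj hjq hm hmq
    have key := integral_comp_mul_left_Ioi
      (fun x : ℝ => ((x ^ ((j : ℝ) / (m : ℝ)) : ℝ) : ℂ) * φ x) 0 hi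
    rw [mul_zero, h6 j m hj hjq hm hmq, smul_zero] at key
    have : ∀ x ∈ Ioi (0 : ℝ), ((x ^ ((j : ℝ) / (m : ℝ)) : ℝ) : ℂ) * rescale ε φ x =
        ((ε⁻¹ * ε ^ ((j : ℝ) / (m : ℝ)) : ℝ) : ℂ) *
          ((((ε⁻¹ * x) ^ ((j : ℝ) / (m : ℝ)) : ℝ) : ℂ) * φ (ε⁻¹ * x)) := by
      intro x hx
      have hx' : x ^ ((j : ℝ) / (m : ℝ)) =
          ε ^ ((j : ℝ) / (m : ℝ)) * (ε⁻¹ * x) ^ ((j : ℝ) / (m : ℝ)) := by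
        rw [← Real.mul_rpow hε.le (mul_nonneg hi.le (le_of_lt hx)), mul_inv_cancel_left₀ hε.ne']
      rw [hx', rescale]
      push_cast
      ring
    rw [setIntegral_congr_fun measurableSet_Ioi this, MeasureTheory.integral_const_mul, key,
      mul_zero]

/-- The index set of the full Colombeau algebra: the mollifiers of order `0`. -/
abbrev Moll : Type := ↥(moll 0)

/-- `φ ↦ φ_ε` on the index set. -/
noncomputable def Moll.scale (φ : Moll) (ε : ℝ) (hε : 0 < ε) : Moll :=
  ⟨rescale ε φ.1, rescale_mem hε φ.2⟩

/-- The set `Γ` of strictly increasing sequences of nonnegative reals diverging to infinity. -/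
def Gam : Set (ℕ → ℝ) := {γ | (∀ k, 0 ≤ γ k) ∧ StrictMono γ ∧ Tendsto γ atTop atTop}

/-! ### Moderate and null growth -/

/-- Moderate growth of a family of quantities `p φ x`, uniformly for `x ∈ K`. -/
def IsModerateOn {X : Type*} (K : Set X) (p : Moll → X → ℝ) : Prop :=
  ∃ N : ℕ, ∀ φ : Moll, φ.1 ∈ moll N → ∃ c : ℝ, 0 < c ∧ ∃ η : ℝ, η ∈ Ioc (0 : ℝ) 1 ∧
    ∀ (ε : ℝ) (hε : 0 < ε), ε < η → ∀ x ∈ K, p (φ.scale ε hε) x ≤ c * ε ^ (-(N : ℝ))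

/-- Null growth of a family of quantities `p φ x`, uniformly for `x ∈ K`. -/
def IsNullOn {X : Type*} (K : Set X) (p : Moll → X → ℝ) : Prop :=
  ∃ N : ℕ, ∃ γ ∈ Gam, ∀ q : ℕ, N ≤ q → ∀ φ : Moll, φ.1 ∈ moll q →
    ∃ c : ℝ, 0 < c ∧ ∃ η : ℝ, η ∈ Ioc (0 : ℝ) 1 ∧
    ∀ (ε : ℝ) (hε : 0 < ε), ε < η → ∀ x ∈ K, p (φ.scale ε hε) x ≤ c * ε ^ (γ q - (N : ℝ))

section growth

variable {X : Type*} {K : Set X} {p r : Moll → X → ℝ}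

theorem Gam.id_mem : (fun k : ℕ => (k : ℝ)) ∈ Gam :=
  ⟨fun k => k.cast_nonneg, Nat.strictMono_cast, tendsto_natCast_atTop_atTop⟩

theorem Gam.min_mem {γ δ : ℕ → ℝ} (hγ : γ ∈ Gam) (hδ : δ ∈ Gam) :
    (fun k => min (γ k) (δ k)) ∈ Gam :=
  ⟨fun k => le_min (hγ.1 k) (hδ.1 k),
    fun _ _ h => min_lt_min (hγ.2.1 h) (hδ.2.1 h), tendsto_inf_atTop _ hγ.2.2 hδ.2.2⟩

theorem IsModerateOn.mono (h : IsModerateOn K r) (hpr : ∀ φ, ∀ x ∈ K, p φ x ≤ r φ x) :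
    IsModerateOn K p := by
  obtain ⟨N, hN⟩ := h
  refine ⟨N, fun φ hφ => ?_⟩
  obtain ⟨c, hc, η, hη, H⟩ := hN φ hφ
  exact ⟨c, hc, η, hη, fun ε hε hεη x hx => (hpr _ x hx).trans (H ε hε hεη x hx)⟩

theorem IsNullOn.mono (h : IsNullOn K r) (hpr : ∀ φ, ∀ x ∈ K, p φ x ≤ r φ x) :
    IsNullOn K p := by
  obtain ⟨N, γ, hγ, hN⟩ := h
  refine ⟨N, γ, hγ, fun q hq φ hφ => ?_⟩
  obtain ⟨c, hc, η, hη, H⟩ := hN q hq φ hφ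
  exact ⟨c, hc, η, hη, fun ε hε hεη x hx => (hpr _ x hx).trans (H ε hε hεη x hx)⟩

theorem IsModerateOn.of_le_const {C : ℝ} (h : ∀ φ, ∀ x ∈ K, p φ x ≤ C) : IsModerateOn K p := by
  refine ⟨0, fun φ _ => ⟨|C| + 1, by positivity, 1, ⟨one_pos, le_rfl⟩, fun ε hε _ x hx => ?_⟩⟩
  have := h (φ.scale ε hε) x hx
  have h2 := le_abs_self C
  simp
  linarith

theorem IsNullOn.of_nonpos (h : ∀ φ, ∀ x ∈ K, p φ x ≤ 0) : IsNullOn K p := by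
  refine ⟨0, _, Gam.id_mem, fun q _ φ _ => ⟨1, one_pos, 1, ⟨one_pos, le_rfl⟩,
    fun ε hε _ x hx => (h _ x hx).trans ?_⟩⟩
  positivity

private theorem rpow_anti {ε a b : ℝ} (hε : 0 < ε) (h1 : ε ≤ 1) (h : b ≤ a) : ε ^ a ≤ ε ^ b :=
  Real.rpow_le_rpow_of_exponent_ge hε h1 h

theorem IsModerateOn.add (hp : IsModerateOn K p) (hr : IsModerateOn K r) :
    IsModerateOn K (fun φ x => p φ x + r φ x) := by
  obtain ⟨N, hN⟩ := hp
  obtain ⟨M, hM⟩ := hr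
  refine ⟨N + M, fun φ hφ => ?_⟩
  obtain ⟨c, hc, η, hη, H⟩ := hN φ (moll_anti (Nat.le_add_right N M) hφ)
  obtain ⟨d, hd, θ, hθ, H'⟩ := hM φ (moll_anti (Nat.le_add_left M N) hφ)
  refine ⟨c + d, by positivity, min η θ, ⟨lt_min hη.1 hθ.1, (min_le_left _ _).trans hη.2⟩,
    fun ε hε hεη x hx => ?_⟩
  have e1 := hεη.trans_le (min_le_left _ _)
  have e2 := hεη.trans_le (min_le_right _ _)
  have hε1 : ε ≤ 1 := e1.le.trans hη.2
  have a1 := H ε hε e1 x hx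
  have a2 := H' ε hε e2 x hx
  have b1 : ε ^ (-(N : ℝ)) ≤ ε ^ (-((N + M : ℕ) : ℝ)) :=
    rpow_anti hε hε1 (by push_cast; linarith [(M.cast_nonneg : (0 : ℝ) ≤ M)])
  have b2 : ε ^ (-(M : ℝ)) ≤ ε ^ (-((N + M : ℕ) : ℝ)) :=
    rpow_anti hε hε1 (by push_cast; linarith [(N.cast_nonneg : (0 : ℝ) ≤ N)])
  have c1 := mul_le_mul_of_nonneg_left b1 hc.le
  have c2 := mul_le_mul_of_nonneg_left b2 hd.le
  rw [add_mul]
  linarith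

theorem IsModerateOn.mul (hp : IsModerateOn K p) (hr : IsModerateOn K r)
    (hr0 : ∀ φ x, 0 ≤ r φ x) : IsModerateOn K (fun φ x => p φ x * r φ x) := by
  obtain ⟨N, hN⟩ := hp
  obtain ⟨M, hM⟩ := hr
  refine ⟨N + M, fun φ hφ => ?_⟩
  obtain ⟨c, hc, η, hη, H⟩ := hN φ (moll_anti (Nat.le_add_right N M) hφ)
  obtain ⟨d, hd, θ, hθ, H'⟩ := hM φ (moll_anti (Nat.le_add_left M N) hφ)
  refine ⟨c * d, by positivity, min η θ, ⟨lt_min hη.1 hθ.1, (min_le_left _ _).trans hη.2⟩,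
    fun ε hε hεη x hx => ?_⟩
  have a1 := H ε hε (hεη.trans_le (min_le_left _ _)) x hx
  have a2 := H' ε hε (hεη.trans_le (min_le_right _ _)) x hx
  refine (mul_le_mul a1 a2 (hr0 _ _) (by positivity)).trans (le_of_eq ?_)
  have : -((N + M : ℕ) : ℝ) = -(N : ℝ) + -(M : ℝ) := by push_cast; ring
  rw [this, Real.rpow_add hε]
  ring

theorem IsNullOn.add (hp : IsNullOn K p) (hr : IsNullOn K r) :
    IsNullOn K (fun φ x => p φ x + r φ x) := by
  obtain ⟨N, γ, hγ, hN⟩ := hp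
  obtain ⟨M, δ, hδ, hM⟩ := hr
  refine ⟨N + M, _, Gam.min_mem hγ hδ, fun q hq φ hφ => ?_⟩
  obtain ⟨c, hc, η, hη, H⟩ := hN q (by omega) φ hφ
  obtain ⟨d, hd, θ, hθ, H'⟩ := hM q (by omega) φ hφ
  refine ⟨c + d, by positivity, min η θ, ⟨lt_min hη.1 hθ.1, (min_le_left _ _).trans hη.2⟩,
    fun ε hε hεη x hx => ?_⟩
  have e1 := hεη.trans_le (min_le_left _ _)
  have e2 := hεη.trans_le (min_le_right _ _)
  have hε1 : ε ≤ 1 := e1.le.trans hη.2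
  have a1 := H ε hε e1 x hx
  have a2 := H' ε hε e2 x hx
  have b1 : ε ^ (γ q - (N : ℝ)) ≤ ε ^ (min (γ q) (δ q) - ((N + M : ℕ) : ℝ)) :=
    rpow_anti hε hε1 (by
      push_cast; linarith [(M.cast_nonneg : (0 : ℝ) ≤ M), min_le_left (γ q) (δ q)])
  have b2 : ε ^ (δ q - (M : ℝ)) ≤ ε ^ (min (γ q) (δ q) - ((N + M : ℕ) : ℝ)) :=
    rpow_anti hε hε1 (by
      push_cast; linarith [(N.cast_nonneg : (0 : ℝ) ≤ N), min_le_right (γ q) (δ q)])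
  have c1 := mul_le_mul_of_nonneg_left b1 hc.le
  have c2 := mul_le_mul_of_nonneg_left b2 hd.le
  rw [add_mul]
  linarith

theorem IsModerateOn.mul_null (hp : IsModerateOn K p) (hr : IsNullOn K r)
    (hr0 : ∀ φ x, 0 ≤ r φ x) : IsNullOn K (fun φ x => p φ x * r φ x) := by
  obtain ⟨N, hN⟩ := hp
  obtain ⟨M, δ, hδ, hM⟩ := hr
  refine ⟨N + M, δ, hδ, fun q hq φ hφ => ?_⟩
  obtain ⟨c, hc, η, hη, H⟩ := hN φ (moll_anti (by omega) hφ)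
  obtain ⟨d, hd, θ, hθ, H'⟩ := hM q (by omega) φ hφ
  refine ⟨c * d, by positivity, min η θ, ⟨lt_min hη.1 hθ.1, (min_le_left _ _).trans hη.2⟩,
    fun ε hε hεη x hx => ?_⟩
  have a1 := H ε hε (hεη.trans_le (min_le_left _ _)) x hx
  have a2 := H' ε hε (hεη.trans_le (min_le_right _ _)) x hx
  refine (mul_le_mul a1 a2 (hr0 _ _) (by positivity)).trans (le_of_eq ?_)
  have : δ q - ((N + M : ℕ) : ℝ) = -(N : ℝ) + (δ q - (M : ℝ)) := by push_cast; ring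
  rw [this, Real.rpow_add hε]
  ring

theorem IsModerateOn.sum {ι : Type*} (s : Finset ι) {P : ι → Moll → X → ℝ}
    (h : ∀ i ∈ s, IsModerateOn K (P i)) : IsModerateOn K (fun φ x => ∑ i ∈ s, P i φ x) := by
  classical
  induction s using Finset.induction_on with
  | empty => exact IsModerateOn.of_le_const (C := 0) (by simp)
  | insert a s ha ih =>
    simp only [Finset.sum_insert ha]
    exact (h a (by simp)).add (ih fun i hi => h i (by simp [hi]))

theorem IsNullOn.sum {ι : Type*} (s : Finset ι) {P : ι → Moll → X → ℝ}
    (h : ∀ i ∈ s, IsNullOn K (P i)) : IsNullOn K (fun φ x => ∑ i ∈ s, P i φ x) := by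
  classical
  induction s using Finset.induction_on with
  | empty => exact IsNullOn.of_nonpos (by simp)
  | insert a s ha ih =>
    simp only [Finset.sum_insert ha]
    exact (h a (by simp)).add (ih fun i hi => h i (by simp [hi]))

end growth

/-! ### The ring of full generalized numbers -/

/-- Moderate families of complex numbers. -/
def IsModerateNum (x : Moll → ℂ) : Prop :=
  ∃ N : ℕ, ∀ φ : Moll, φ.1 ∈ moll N → ∃ c : ℝ, 0 < c ∧ ∃ η : ℝ, η ∈ Ioc (0 : ℝ) 1 ∧
    ∀ (ε : ℝ) (hε : 0 < ε), ε < η → ‖x (φ.scale ε hε)‖ ≤ c * ε ^ (-(N : ℝ))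

/-- Null families of complex numbers. -/
def IsNullNum (x : Moll → ℂ) : Prop :=
  ∃ N : ℕ, ∃ γ ∈ Gam, ∀ q : ℕ, N ≤ q → ∀ φ : Moll, φ.1 ∈ moll q →
    ∃ c : ℝ, 0 < c ∧ ∃ η : ℝ, η ∈ Ioc (0 : ℝ) 1 ∧
    ∀ (ε : ℝ) (hε : 0 < ε), ε < η → ‖x (φ.scale ε hε)‖ ≤ c * ε ^ (γ q - (N : ℝ))

theorem isModerateNum_iff {X : Type*} {K : Set X} (hK : K.Nonempty) (x : Moll → ℂ) :
    IsModerateNum x ↔ IsModerateOn K (fun φ _ => ‖x φ‖) := by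
  obtain ⟨k, hk⟩ := hK
  refine exists_congr fun N => forall₂_congr fun φ _ => exists_congr fun c => and_congr_right
    fun _ => exists_congr fun η => and_congr_right fun _ => forall₃_congr fun ε hε _ => ?_
  exact ⟨fun h _ _ => h, fun h => h k hk⟩

theorem isNullNum_iff {X : Type*} {K : Set X} (hK : K.Nonempty) (x : Moll → ℂ) :
    IsNullNum x ↔ IsNullOn K (fun φ _ => ‖x φ‖) := by
  obtain ⟨k, hk⟩ := hK
  refine exists_congr fun N => exists_congr fun γ => and_congr_right fun _ =>
    forall₄_congr fun q _ φ _ => exists_congr fun c => and_congr_right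
    fun _ => exists_congr fun η => and_congr_right fun _ => forall₃_congr fun ε hε _ => ?_
  exact ⟨fun h _ _ => h, fun h => h k hk⟩

private theorem modNum_iff (x : Moll → ℂ) :
    IsModerateNum x ↔ IsModerateOn (univ : Set Unit) (fun φ _ => ‖x φ‖) :=
  isModerateNum_iff univ_nonempty x

private theorem nullNum_iff (x : Moll → ℂ) :
    IsNullNum x ↔ IsNullOn (univ : Set Unit) (fun φ _ => ‖x φ‖) :=
  isNullNum_iff univ_nonempty x

/-- The ring of moderate families of complex numbers. -/
def moderateNum : Subring (Moll → ℂ) where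
  carrier := {x | IsModerateNum x}
  mul_mem' {x y} hx hy := by
    simp only [mem_ofPred_eq, modNum_iff] at hx hy ⊢
    exact (hx.mul hy fun _ _ => norm_nonneg _).mono fun φ _ _ => (norm_mul_le _ _)
  one_mem' := (modNum_iff _).2 (IsModerateOn.of_le_const (C := 1) (by simp))
  add_mem' {x y} hx hy := by
    simp only [mem_ofPred_eq, modNum_iff] at hx hy ⊢
    exact (hx.add hy).mono fun φ _ _ => norm_add_le _ _
  zero_mem' := (modNum_iff _).2 (IsModerateOn.of_le_const (C := 0) (by simp))
  neg_mem' {x} hx := by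
    simp only [mem_ofPred_eq, modNum_iff] at hx ⊢
    simpa using hx

theorem mem_moderateNum {x : Moll → ℂ} : x ∈ moderateNum ↔ IsModerateNum x := Iff.rfl

/-- The ideal of null families of complex numbers. -/
def nullNum : Ideal moderateNum where
  carrier := {x | IsNullNum x.1}
  add_mem' {x y} hx hy := by
    simp only [mem_ofPred_eq, nullNum_iff] at hx hy ⊢
    exact (hx.add hy).mono fun φ _ _ => norm_add_le _ _
  zero_mem' := (nullNum_iff _).2 (IsNullOn.of_nonpos (by simp))
  smul_mem' x y hy := by
    have hx : IsModerateNum x.1 := x.2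
    simp only [mem_ofPred_eq, nullNum_iff, modNum_iff] at hx hy ⊢
    exact (hx.mul_null hy fun _ _ => norm_nonneg _).mono fun φ _ _ => norm_mul_le _ _

theorem mem_nullNum {x : moderateNum} : x ∈ nullNum ↔ IsNullNum x.1 := Iff.rfl

/-- The ring of Colombeau's full generalized complex numbers. -/
def GenNum : Type := moderateNum ⧸ nullNum

noncomputable instance : CommRing GenNum := inferInstanceAs (CommRing (moderateNum ⧸ nullNum))

/-- The class in `GenNum` of a moderate family of numbers. -/
noncomputable def GenNum.mk : moderateNum →+* GenNum := Ideal.Quotient.mk nullNum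

/-! ### The algebra of full generalized functions -/

section functions

variable {n : ℕ} (Ω : Opens (EuclideanSpace ℂ (Fin n)))

/-- Moderate families of functions on `Ω`: each `u φ` is smooth on `Ω` (in the real sense), and each
derivative, of any order `m`, has moderate growth on each compact subset of `Ω`. The norm of the
`m`-th derivative controls, and is controlled by, all partial derivatives of order `m` with respect
to the `2 n` real coordinates. The values of `u φ` outside `Ω` play no role. -/
def IsModerateFun (u : Moll → EuclideanSpace ℂ (Fin n) → ℂ) : Prop :=
  (∀ φ, ContDiffOn ℝ ∞ (u φ) Ω) ∧
    ∀ K : Set (EuclideanSpace ℂ (Fin n)), IsCompact K → K ⊆ Ω → ∀ m : ℕ,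
      IsModerateOn K fun φ x => ‖iteratedFDeriv ℝ m (u φ) x‖

/-- Null families of functions on `Ω`: each derivative has null growth on each compact subset. -/
def IsNullFun (u : Moll → EuclideanSpace ℂ (Fin n) → ℂ) : Prop :=
  ∀ K : Set (EuclideanSpace ℂ (Fin n)), IsCompact K → K ⊆ Ω → ∀ m : ℕ,
    IsNullOn K fun φ x => ‖iteratedFDeriv ℝ m (u φ) x‖

variable {Ω}

theorem contDiffAt_of_mem {f : EuclideanSpace ℂ (Fin n) → ℂ} (hf : ContDiffOn ℝ ∞ f Ω)
    {x : EuclideanSpace ℂ (Fin n)} (hx : x ∈ Ω) (m : ℕ) : ContDiffAt ℝ m f x :=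
  (hf.contDiffAt (Ω.isOpen.mem_nhds hx)).of_le (by exact_mod_cast le_top)

private theorem norm_iter_add {f g : EuclideanSpace ℂ (Fin n) → ℂ} (hf : ContDiffOn ℝ ∞ f Ω)
    (hg : ContDiffOn ℝ ∞ g Ω) {x : EuclideanSpace ℂ (Fin n)} (hx : x ∈ Ω) (m : ℕ) :
    ‖iteratedFDeriv ℝ m (f + g) x‖ ≤ ‖iteratedFDeriv ℝ m f x‖ + ‖iteratedFDeriv ℝ m g x‖ := by
  rw [iteratedFDeriv_add_apply (contDiffAt_of_mem hf hx m) (contDiffAt_of_mem hg hx m)]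
  exact norm_add_le _ _

private theorem norm_iter_mul {f g : EuclideanSpace ℂ (Fin n) → ℂ} (hf : ContDiffOn ℝ ∞ f Ω)
    (hg : ContDiffOn ℝ ∞ g Ω) {x : EuclideanSpace ℂ (Fin n)} (hx : x ∈ Ω) (m : ℕ) :
    ‖iteratedFDeriv ℝ m (f * g) x‖ ≤ ∑ i ∈ Finset.range (m + 1),
      (m.choose i : ℝ) * ‖iteratedFDeriv ℝ i f x‖ * ‖iteratedFDeriv ℝ (m - i) g x‖ := by
  have h := norm_iteratedFDerivWithin_mul_le hf hg Ω.isOpen.uniqueDiffOn hx (n := m)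
    (by exact_mod_cast le_top)
  simp only [iteratedFDerivWithin_of_isOpen _ Ω.isOpen hx] at h
  exact h

variable (Ω)

/-- The ring of moderate families of functions on `Ω`. -/
def moderateFun : Subring (Moll → EuclideanSpace ℂ (Fin n) → ℂ) where
  carrier := {u | IsModerateFun Ω u}
  mul_mem' {u v} hu hv := by
    refine ⟨fun φ => (hu.1 φ).mul (hv.1 φ), fun K hK hKΩ m => ?_⟩
    refine IsModerateOn.mono (IsModerateOn.sum (Finset.range (m + 1)) fun i _ =>
      ((IsModerateOn.of_le_const (p := fun _ _ => (m.choose i : ℝ)) fun _ _ _ => le_rfl).mul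
        (hu.2 K hK hKΩ i) fun _ _ => norm_nonneg _).mul
        (hv.2 K hK hKΩ (m - i)) fun _ _ => norm_nonneg _) ?_
    exact fun φ x hx => norm_iter_mul (hu.1 φ) (hv.1 φ) (hKΩ hx) m
  one_mem' := by
    refine ⟨fun φ => contDiffOn_const, fun K hK hKΩ m => ?_⟩
    refine IsModerateOn.of_le_const (C := 1) fun φ x _ => ?_
    rcases Nat.eq_zero_or_pos m with rfl | hm
    · simp
    · have : iteratedFDeriv ℝ m ((1 : Moll → EuclideanSpace ℂ (Fin n) → ℂ) φ) x = 0 := by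
        have := iteratedFDeriv_const_of_ne (𝕜 := ℝ) (E := EuclideanSpace ℂ (Fin n)) hm.ne' (1 : ℂ)
        exact congrFun this x
      rw [this]
      simp
  add_mem' {u v} hu hv := by
    refine ⟨fun φ => (hu.1 φ).add (hv.1 φ), fun K hK hKΩ m => ?_⟩
    exact ((hu.2 K hK hKΩ m).add (hv.2 K hK hKΩ m)).mono fun φ x hx =>
      norm_iter_add (hu.1 φ) (hv.1 φ) (hKΩ hx) m
  zero_mem' := by
    refine ⟨fun φ => contDiffOn_const, fun K hK hKΩ m => ?_⟩
    refine IsModerateOn.of_le_const (C := 0) fun φ x _ => ?_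
    simp
  neg_mem' {u} hu := by
    refine ⟨fun φ => (hu.1 φ).neg, fun K hK hKΩ m => ?_⟩
    refine (hu.2 K hK hKΩ m).mono fun φ x _ => ?_
    simp [iteratedFDeriv_neg_apply]

theorem mem_moderateFun {u : Moll → EuclideanSpace ℂ (Fin n) → ℂ} :
    u ∈ moderateFun Ω ↔ IsModerateFun Ω u := Iff.rfl

/-- The ideal of null families of functions on `Ω`. -/
def nullFun : Ideal (moderateFun Ω) where
  carrier := {u | IsNullFun Ω u.1}
  add_mem' {u v} hu hv := fun K hK hKΩ m =>
    ((hu K hK hKΩ m).add (hv K hK hKΩ m)).mono fun φ x hx =>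
      norm_iter_add (u.2.1 φ) (v.2.1 φ) (hKΩ hx) m
  zero_mem' := fun K hK hKΩ m => IsNullOn.of_nonpos fun φ x _ => by simp
  smul_mem' u v hv := fun K hK hKΩ m => by
    refine IsNullOn.mono (IsNullOn.sum (Finset.range (m + 1)) fun i _ =>
      IsModerateOn.mul_null
        ((IsModerateOn.of_le_const (p := fun _ _ => (m.choose i : ℝ)) fun _ _ _ => le_rfl).mul
        (u.2.2 K hK hKΩ i) fun _ _ => norm_nonneg _)
        (hv K hK hKΩ (m - i)) fun _ _ => norm_nonneg _) ?_
    exact fun φ x hx => norm_iter_mul (u.2.1 φ) (v.2.1 φ) (hKΩ hx) m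

theorem mem_nullFun {u : moderateFun Ω} : u ∈ nullFun Ω ↔ IsNullFun Ω u.1 := Iff.rfl

/-- The algebra `𝒢(Ω)` of Colombeau's full generalized functions on `Ω`. -/
def GenFun : Type := moderateFun Ω ⧸ nullFun Ω

noncomputable instance : CommRing (GenFun Ω) :=
  inferInstanceAs (CommRing (moderateFun Ω ⧸ nullFun Ω))

/-- The class in `𝒢(Ω)` of a moderate family of functions. -/
noncomputable def GenFun.mk : moderateFun Ω →+* GenFun Ω := Ideal.Quotient.mk (nullFun Ω)

/-! ### Generalized numbers as constant generalized functions -/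

private theorem norm_iter_const_le (m : ℕ) (c : ℂ) (x : EuclideanSpace ℂ (Fin n)) :
    ‖iteratedFDeriv ℝ m (fun _ : EuclideanSpace ℂ (Fin n) => c) x‖ ≤ ‖c‖ := by
  rcases Nat.eq_zero_or_pos m with rfl | hm
  · simp
  · have := iteratedFDeriv_const_of_ne (𝕜 := ℝ) (E := EuclideanSpace ℂ (Fin n)) hm.ne' c
    rw [this]
    simp

/-- A moderate family of numbers, as a moderate family of constant functions. -/
def constFun : moderateNum →+* moderateFun Ω where
  toFun x := ⟨fun φ _ => x.1 φ, fun φ => contDiffOn_const, fun K _ _ m => by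
    rcases K.eq_empty_or_nonempty with rfl | hK
    · exact IsModerateOn.of_le_const (C := 0) (by simp)
    · exact ((isModerateNum_iff hK x.1).1 x.2).mono fun φ y _ => norm_iter_const_le m _ y⟩
  map_one' := rfl
  map_mul' _ _ := rfl
  map_zero' := rfl
  map_add' _ _ := rfl

theorem constFun_mem {x : moderateNum} (hx : x ∈ nullNum) : constFun Ω x ∈ nullFun Ω := by
  intro K _ _ m
  rcases K.eq_empty_or_nonempty with rfl | hK
  · exact IsNullOn.of_nonpos (by simp)
  · exact ((isNullNum_iff hK x.1).1 hx).mono fun φ y _ => norm_iter_const_le m _ y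

/-- `𝒢(Ω)` is an algebra over the ring of generalized numbers, which act as constants. -/
noncomputable instance : Algebra GenNum (GenFun Ω) :=
  RingHom.toAlgebra (R := GenNum) (S := GenFun Ω)
    (Ideal.quotientMap (nullFun Ω) (constFun Ω) (fun _ hx => constFun_mem Ω hx))

theorem smul_mk (x : moderateNum) (u : moderateFun Ω) :
    GenNum.mk x • GenFun.mk Ω u = GenFun.mk Ω (constFun Ω x * u) := rfl

/-! ### Derivatives -/

/-- The Wirtinger derivative `∂/∂z_k = (∂/∂x_k - i ∂/∂y_k) / 2` of a function. -/
noncomputable def wirtinger (k : Fin n) (f : EuclideanSpace ℂ (Fin n) → ℂ) :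
    EuclideanSpace ℂ (Fin n) → ℂ := fun z =>
  (1 / 2 : ℂ) * (fderiv ℝ f z (EuclideanSpace.single k 1) -
    Complex.I * fderiv ℝ f z (EuclideanSpace.single k Complex.I))

variable {Ω} in
theorem wirtinger_contDiffOn (k : Fin n) {f : EuclideanSpace ℂ (Fin n) → ℂ}
    (hf : ContDiffOn ℝ ∞ f Ω) : ContDiffOn ℝ ∞ (wirtinger k f) Ω := by
  have h : ContDiffOn ℝ ∞ (fderiv ℝ f) Ω := hf.fderiv_of_isOpen Ω.isOpen (by simp)
  exact contDiffOn_const.mul ((h.clm_apply contDiffOn_const).sub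
    (contDiffOn_const.mul (h.clm_apply contDiffOn_const)))

variable {Ω} in
theorem norm_iter_wirtinger_le (k : Fin n) {f : EuclideanSpace ℂ (Fin n) → ℂ}
    (hf : ContDiffOn ℝ ∞ f Ω) {x : EuclideanSpace ℂ (Fin n)} (hx : x ∈ Ω) (m : ℕ) :
    ‖iteratedFDeriv ℝ m (wirtinger k f) x‖ ≤ ‖iteratedFDeriv ℝ (m + 1) f x‖ := by
  have hf' : ContDiffOn ℝ ∞ (fderiv ℝ f) Ω := hf.fderiv_of_isOpen Ω.isOpen (by simp)
  have hx' : ContDiffAt ℝ m (fderiv ℝ f) x :=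
    (hf'.contDiffAt (Ω.isOpen.mem_nhds hx)).of_le (by exact_mod_cast le_top)
  have hv (v : EuclideanSpace ℂ (Fin n)) : ContDiffAt ℝ m (fun z => fderiv ℝ f z v) x :=
    hx'.clm_apply contDiffAt_const
  have bd (v : EuclideanSpace ℂ (Fin n)) (h1 : ‖v‖ = 1) :
      ‖iteratedFDeriv ℝ m (fun z => fderiv ℝ f z v) x‖ ≤ ‖iteratedFDeriv ℝ (m + 1) f x‖ := by
    have := norm_iteratedFDeriv_clm_apply_const (c := v) hx' le_rfl
    rwa [h1, one_mul, norm_iteratedFDeriv_fderiv] at this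
  have b1 := bd (EuclideanSpace.single k 1) (by simp)
  have b2 := bd (EuclideanSpace.single k Complex.I) (by simp)
  set g : EuclideanSpace ℂ (Fin n) → ℂ := fun z => fderiv ℝ f z (EuclideanSpace.single k 1)
  set h : EuclideanSpace ℂ (Fin n) → ℂ := fun z =>
    fderiv ℝ f z (EuclideanSpace.single k Complex.I)
  have hg : ContDiffAt ℝ m g x := hv _
  have hh : ContDiffAt ℝ m h x := hv _
  have e : wirtinger k f = (1 / 2 : ℂ) • (g + (-Complex.I) • h) := by
    funext z
    simp only [wirtinger, Pi.smul_apply, Pi.add_apply, smul_eq_mul, g, h]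
    ring
  have hIh : ContDiffAt ℝ m ((-Complex.I) • h) x := ContDiffAt.const_smul (-Complex.I) hh
  have hsum : ContDiffAt ℝ m (g + (-Complex.I) • h) x := hg.add hIh
  rw [e, iteratedFDeriv_const_smul_apply hsum, iteratedFDeriv_add_apply hg hIh,
    iteratedFDeriv_const_smul_apply hh, norm_smul]
  refine (mul_le_mul_of_nonneg_left (norm_add_le _ _) (norm_nonneg _)).trans ?_
  rw [norm_smul]
  norm_num
  linarith

/-- `∂/∂z_k` on moderate families. -/
noncomputable def wirtingerMod (k : Fin n) (u : moderateFun Ω) : moderateFun Ω :=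
  ⟨fun φ => wirtinger k (u.1 φ), fun φ => wirtinger_contDiffOn k (u.2.1 φ),
    fun K hK hKΩ m => (u.2.2 K hK hKΩ (m + 1)).mono fun φ _ hx =>
      norm_iter_wirtinger_le k (u.2.1 φ) (hKΩ hx) m⟩

theorem wirtingerMod_sub_mem (k : Fin n) {u v : moderateFun Ω} (h : u - v ∈ nullFun Ω) :
    wirtingerMod Ω k u - wirtingerMod Ω k v ∈ nullFun Ω := by
  have h' : wirtingerMod Ω k (u - v) ∈ nullFun Ω := fun K hK hKΩ m =>
    (h K hK hKΩ (m + 1)).mono fun φ _ hx =>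
      norm_iter_wirtinger_le k ((u - v).2.1 φ) (hKΩ hx) m
  have e : ∀ φ, ∀ x ∈ Ω, wirtinger k ((u - v).1 φ) x =
      (wirtingerMod Ω k u - wirtingerMod Ω k v).1 φ x := by
    intro φ x hx
    have du := (contDiffAt_of_mem (u.2.1 φ) hx 1).differentiableAt (by simp)
    have dv := (contDiffAt_of_mem (v.2.1 φ) hx 1).differentiableAt (by simp)
    have : fderiv ℝ ((u - v).1 φ) x = fderiv ℝ (u.1 φ) x - fderiv ℝ (v.1 φ) x := fderiv_sub du dv
    change _ = wirtinger k (u.1 φ) x - wirtinger k (v.1 φ) x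
    simp only [wirtinger, this, sub_apply]
    ring
  intro K hK hKΩ m
  refine (h' K hK hKΩ m).mono fun φ x hx => le_of_eq ?_
  have : (wirtingerMod Ω k u - wirtingerMod Ω k v).1 φ =ᶠ[𝓝 x] wirtinger k ((u - v).1 φ) := by
    filter_upwards [Ω.isOpen.mem_nhds (hKΩ hx)] with y hy using (e φ y hy).symm
  rw [(this.iteratedFDeriv ℝ m).eq_of_nhds]
  rfl

/-- The derivative `∂/∂z_k` on `𝒢(Ω)`, computed on representatives. -/
noncomputable def dz (k : Fin n) (u : GenFun Ω) : GenFun Ω :=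
  Quotient.liftOn' u (fun v => GenFun.mk Ω (wirtingerMod Ω k v))
    (fun _ _ hab => Ideal.Quotient.eq.2
      (wirtingerMod_sub_mem Ω k ((Submodule.quotientRel_def _).1 hab)))

theorem dz_mk (k : Fin n) (u : moderateFun Ω) :
    dz Ω k (GenFun.mk Ω u) = GenFun.mk Ω (wirtingerMod Ω k u) := rfl

/-- The operator `L = ∑_{1 ≤ k ≤ m} a_k ∂/∂z_k` on `𝒢(Ω)`, for `m ≤ n`, with coefficients in the ring
of generalized numbers. -/
noncomputable def diffOp {m : ℕ} (hm : m ≤ n) (a : Fin m → GenNum) (u : GenFun Ω) : GenFun Ω :=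
  ∑ k : Fin m, a k • dz Ω (Fin.castLE hm k) u

/-! ### Smooth and holomorphic functions as generalized functions -/

/-- A smooth function on `Ω`, as an element of `𝒢(Ω)`: the class of the constant family. -/
noncomputable def ofSmooth (f : EuclideanSpace ℂ (Fin n) → ℂ) (hf : ContDiffOn ℝ ∞ f Ω) :
    GenFun Ω :=
  GenFun.mk Ω ⟨fun _ => f, fun _ => hf, fun K hK hKΩ m => by
    have hc : ContinuousOn (fun x => ‖iteratedFDeriv ℝ m f x‖) K := by
      have h := (hf.continuousOn_iteratedFDerivWithin (m := m) (by exact_mod_cast le_top)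
        Ω.isOpen.uniqueDiffOn).congr
          (g := iteratedFDeriv ℝ m f)
          fun x hx => (iteratedFDerivWithin_of_isOpen m Ω.isOpen hx).symm
      exact (h.mono hKΩ).norm
    obtain ⟨C, hC⟩ := (hK.image_of_continuousOn hc).bddAbove
    exact IsModerateOn.of_le_const (C := C) fun φ x hx => hC ⟨x, hx, rfl⟩⟩

variable {Ω} in
/-- Directional derivatives of a holomorphic function of several variables are holomorphic. -/
theorem differentiableOn_fderiv_apply {f : EuclideanSpace ℂ (Fin n) → ℂ}
    (hf : DifferentiableOn ℂ f Ω) (v : EuclideanSpace ℂ (Fin n)) :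
    DifferentiableOn ℂ (fun z => fderiv ℂ f z v) Ω := by
  intro z₀ hz₀
  refine DifferentiableAt.differentiableWithinAt ?_
  obtain ⟨r, hr, hball⟩ : ∃ r > 0, ∀ z ∈ Metric.ball z₀ (3 * r), z ∈ Ω ∧ dist (f z) (f z₀) < 1 / 2 := by
    have h1 := (hf.continuousOn.continuousAt (Ω.isOpen.mem_nhds hz₀)).eventually
      (Metric.ball_mem_nhds (f z₀) (ε := 1 / 2) (by norm_num))
    obtain ⟨ρ, hρ, H⟩ := Metric.eventually_nhds_iff_ball.1
      ((Ω.isOpen.eventually_mem hz₀).and h1)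
    exact ⟨ρ / 3, by positivity, fun z hz => H z (by rwa [mul_div_cancel₀ _ (by norm_num)] at hz)⟩
  have hd : ∀ z ∈ Metric.ball z₀ (3 * r), DifferentiableAt ℂ f z := fun z hz =>
    hf.differentiableAt (Ω.isOpen.mem_nhds (hball z hz).1)
  have hB : ∀ z ∈ Metric.ball z₀ (2 * r), ‖fderiv ℂ f z‖ ≤ 1 / r := by
    intro z hz
    have hsub : Metric.ball z r ⊆ Metric.ball z₀ (3 * r) := by
      refine Metric.ball_subset_ball' ?_
      have := Metric.mem_ball.1 hz
      linarith
    refine Complex.norm_fderiv_le_div_of_mapsTo_ball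
      (fun w hw => (hd w (hsub hw)).differentiableWithinAt) (fun w hw => ?_) hr
    have h1 := (hball w (hsub hw)).2
    have h2 := (hball z (hsub (Metric.mem_ball_self hr))).2
    have := dist_triangle_right (f w) (f z) (f z₀)
    exact Metric.mem_closedBall.2 (by linarith)
  set R : ℝ := r / (‖v‖ + 1) with hRdef
  have hR : 0 < R := by positivity
  have hRv : R * ‖v‖ < r := by
    rw [hRdef, div_mul_eq_mul_div, div_lt_iff₀ (by positivity)]
    nlinarith [norm_nonneg v]
  have hin : ∀ z ∈ Metric.ball z₀ r, ∀ ζ : ℂ, ‖ζ‖ ≤ R → z + ζ • v ∈ Metric.ball z₀ (2 * r) := by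
    intro z hz ζ hζ
    have h1 := Metric.mem_ball.1 hz
    have h2 : dist (z + ζ • v) z ≤ R * ‖v‖ := by
      rw [dist_eq_norm, add_sub_cancel_left, norm_smul]
      gcongr
    have := dist_triangle (z + ζ • v) z z₀
    exact Metric.mem_ball.2 (by linarith)
  have h23 : Metric.ball z₀ (2 * r) ⊆ Metric.ball z₀ (3 * r) :=
    Metric.ball_subset_ball (by linarith)
  have hline : ∀ z ∈ Metric.ball z₀ r, ∀ ζ : ℂ, ‖ζ‖ ≤ R →
      HasDerivAt (fun ζ : ℂ => f (z + ζ • v)) (fderiv ℂ f (z + ζ • v) v) ζ := by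
    intro z hz ζ hζ
    have h1 : HasDerivAt (fun ζ : ℂ => z + ζ • v) v ζ := by
      simpa using ((hasDerivAt_id ζ).smul_const v).const_add z
    exact (hd _ (h23 (hin z hz ζ hζ))).hasFDerivAt.comp_hasDerivAt ζ h1
  -- the Cauchy formula for the derivative along the line through `z` in direction `v`
  set w : ℝ → ℂ := fun θ => deriv (circleMap 0 R) θ * (1 / (circleMap 0 R θ) ^ 2) with hw
  have hcirc : ∀ θ, ‖circleMap 0 R θ‖ = R := fun θ => by simp [abs_of_pos hR]
  have hcirc0 : ∀ θ, circleMap 0 R θ ≠ 0 := fun θ h => by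
    have := hcirc θ
    rw [h, norm_zero] at this
    exact hR.ne this
  have hwc : Continuous w := by
    have h1 : Continuous (circleMap 0 R) := continuous_circleMap 0 R
    simp only [hw, deriv_circleMap]
    exact (h1.mul continuous_const).mul
      (continuous_const.div (h1.pow 2) fun θ => pow_ne_zero 2 (hcirc0 θ))
  have hformula : ∀ z ∈ Metric.ball z₀ r, (∫ θ in (0 : ℝ)..2 * Real.pi,
      w θ * f (z + circleMap 0 R θ • v)) = (2 * Real.pi * Complex.I) * fderiv ℂ f z v := by
    intro z hz
    have hdc : DiffContOnCl ℂ (fun ζ : ℂ => f (z + ζ • v)) (Metric.ball 0 R) := by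
      refine DifferentiableOn.diffContOnCl fun ζ hζ => ?_
      rw [closure_ball _ hR.ne'] at hζ
      exact (hline z hz ζ (by simpa using hζ)).differentiableAt.differentiableWithinAt
    have h := hdc.deriv_eq_smul_circleIntegral hR
    have h0 := (hline z hz 0 (by simpa using hR.le)).deriv
    simp only [zero_smul, add_zero] at h0
    rw [h0, circleIntegral] at h
    simp only [sub_zero, smul_eq_mul] at h
    rw [← h]
    refine intervalIntegral.integral_congr fun θ _ => ?_
    simp only [hw]
    ring
  have hcont : ∀ z ∈ Metric.ball z₀ r, Continuous fun θ : ℝ => w θ * f (z + circleMap 0 R θ • v) := by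
    intro z hz
    refine hwc.mul (continuous_iff_continuousAt.2 fun θ => ?_)
    have h1 := (hline z hz _ (hcirc θ).le).continuousAt
    exact ContinuousAt.comp (f := circleMap 0 R) h1 (continuous_circleMap 0 R).continuousAt
  have hmeas : Measurable fun θ : ℝ => w θ • fderiv ℂ f (z₀ + circleMap 0 R θ • v) := by
    have h1 : Measurable fun θ : ℝ => fderiv ℂ f (z₀ + circleMap 0 R θ • v) :=
      (measurable_fderiv ℂ f).comp (by
        have := continuous_circleMap 0 R
        exact Continuous.measurable (by fun_prop))
    exact hwc.measurable.smul h1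
  have key := intervalIntegral.hasFDerivAt_integral_of_dominated_of_fderiv_le (𝕜 := ℂ)
    (μ := volume) (a := 0) (b := 2 * Real.pi) (s := Metric.ball z₀ r) (x₀ := z₀)
    (F := fun z θ => w θ * f (z + circleMap 0 R θ • v))
    (F' := fun z θ => w θ • fderiv ℂ f (z + circleMap 0 R θ • v))
    (bound := fun θ => ‖w θ‖ * (1 / r)) (Metric.ball_mem_nhds _ hr)
    (by
      filter_upwards [Metric.ball_mem_nhds z₀ hr] with z hz
      exact (hcont z hz).aestronglyMeasurable)
    ((hcont z₀ (Metric.mem_ball_self hr)).intervalIntegrable _ _)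
    hmeas.aestronglyMeasurable
    (Eventually.of_forall fun θ _ z hz => by
      rw [norm_smul]
      exact mul_le_mul_of_nonneg_left (hB _ (hin z hz _ (hcirc θ).le)) (norm_nonneg _))
    ((hwc.norm.mul continuous_const).intervalIntegrable _ _)
    (Eventually.of_forall fun θ _ z hz => by
      have h1 := (hd _ (h23 (hin z hz _ (hcirc θ).le))).hasFDerivAt
      have h2 : HasFDerivAt (fun z => f (z + circleMap 0 R θ • v))
          (fderiv ℂ f (z + circleMap 0 R θ • v)) z :=
        (hasFDerivAt_comp_add_right (circleMap 0 R θ • v)).2 h1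
      exact h2.const_mul (w θ))
  have h2 : DifferentiableAt ℂ (fun z => (2 * Real.pi * Complex.I) * fderiv ℂ f z v) z₀ := by
    refine key.differentiableAt.congr_of_eventuallyEq ?_
    filter_upwards [Metric.ball_mem_nhds z₀ hr] with z hz using (hformula z hz).symm
  have h3 := h2.const_mul ((2 * Real.pi * Complex.I : ℂ)⁻¹)
  have hpi : (2 * Real.pi * Complex.I : ℂ) ≠ 0 := Complex.two_pi_I_ne_zero
  simpa only [inv_mul_cancel_left₀ hpi] using h3

variable {Ω} in
/-- A holomorphic function of several variables is smooth. -/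
theorem contDiffOn_of_holomorphic {f : EuclideanSpace ℂ (Fin n) → ℂ}
    (hf : DifferentiableOn ℂ f Ω) : ContDiffOn ℝ ∞ f Ω := by
  have key : ∀ (m : ℕ) (g : EuclideanSpace ℂ (Fin n) → ℂ), DifferentiableOn ℂ g Ω →
      ContDiffOn ℂ m g Ω := by
    intro m
    induction m with
    | zero => exact fun g hg => contDiffOn_zero.2 hg.continuousOn
    | succ m ih =>
      intro g hg
      refine (contDiffOn_succ_iff_fderiv_of_isOpen (n := m) Ω.isOpen).2 ⟨hg, by simp, ?_⟩
      exact contDiffOn_clm_apply.2 fun v => ih _ (differentiableOn_fderiv_apply hg v)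
  exact (contDiffOn_infty.2 fun m => key m f hf).restrict_scalars ℝ

/-- A holomorphic function on `Ω`, as an element of `𝒢(Ω)`. -/
noncomputable def ofHolomorphic (f : EuclideanSpace ℂ (Fin n) → ℂ)
    (hf : DifferentiableOn ℂ f Ω) : GenFun Ω :=
  ofSmooth Ω f (contDiffOn_of_holomorphic hf)

end functions

end ColombeauFull

/-!
Generalized functions have point values: for `x ∈ Ω`, evaluating representatives at `x` gives a ring
homomorphism `𝒢(Ω) → GenNum` (`evalAt`), because `{x}` is compact and the growth estimates of order
`0` on `{x}` are exactly the estimates for generalized numbers. This homomorphism is linear over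
`GenNum`, so it sends `L(u) = ∑ a_k ∂u/∂z_k` to `∑ a_k (∂u/∂z_k)(x)`, a point of the ideal generated
by the `a_k`. A non-constant `f` is nonzero at some `x`, and there the value of `L(u) = f` is the
nonzero complex number `f x`, which is a unit of `GenNum`; hence the ideal is the whole ring.
-/

namespace ColombeauFull

/-- An ordinary complex number, as a moderate family: the constant family. -/
def constNum : ℂ →+* moderateNum where
  toFun c := ⟨fun _ => c, (isModerateNum_iff (K := (univ : Set Unit)) univ_nonempty _).2
    (IsModerateOn.of_le_const (C := ‖c‖) fun _ _ _ => le_rfl)⟩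
  map_one' := rfl
  map_mul' _ _ := rfl
  map_zero' := rfl
  map_add' _ _ := rfl

section pointValues

variable {n : ℕ} {Ω : Opens (EuclideanSpace ℂ (Fin n))} {x : EuclideanSpace ℂ (Fin n)}

/-- Evaluation of moderate families of functions at a point of `Ω`. -/
def evalMod (hx : x ∈ Ω) : moderateFun Ω →+* moderateNum where
  toFun u := ⟨fun φ => u.1 φ x, mem_moderateNum.2 <| (isModerateNum_iff (singleton_nonempty x) _).2 <|
    (u.2.2 {x} isCompact_singleton (singleton_subset_iff.2 hx) 0).mono fun φ y hy => by
      rw [mem_singleton_iff.1 hy, norm_iteratedFDeriv_zero]⟩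
  map_one' := rfl
  map_mul' _ _ := rfl
  map_zero' := rfl
  map_add' _ _ := rfl

theorem evalMod_mem_nullNum (hx : x ∈ Ω) {u : moderateFun Ω} (hu : u ∈ nullFun Ω) :
    evalMod hx u ∈ nullNum :=
  (isNullNum_iff (singleton_nonempty x) _).2
    ((hu {x} isCompact_singleton (singleton_subset_iff.2 hx) 0).mono fun φ y hy => by
      rw [mem_singleton_iff.1 hy, norm_iteratedFDeriv_zero]
      rfl)

/-- The point value of a generalized function at a point of `Ω`, a generalized number. -/
noncomputable def evalAt (hx : x ∈ Ω) : GenFun Ω →+* GenNum :=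
  Ideal.quotientMap nullNum (evalMod hx) fun _ hu => evalMod_mem_nullNum hx hu

theorem evalAt_mk (hx : x ∈ Ω) (u : moderateFun Ω) :
    evalAt hx (GenFun.mk Ω u) = GenNum.mk (evalMod hx u) := rfl

theorem evalAt_smul (hx : x ∈ Ω) (a : GenNum) (u : GenFun Ω) :
    evalAt hx (a • u) = a * evalAt hx u := by
  obtain ⟨b, rfl⟩ : ∃ b, GenNum.mk b = a := Ideal.Quotient.mk_surjective a
  obtain ⟨v, rfl⟩ : ∃ v, GenFun.mk Ω v = u := Ideal.Quotient.mk_surjective u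
  rw [smul_mk, evalAt_mk, evalAt_mk, ← map_mul, map_mul (evalMod hx)]
  rfl

theorem evalAt_diffOp_mem_span (hx : x ∈ Ω) {m : ℕ} (hm : m ≤ n) (a : Fin m → GenNum)
    (u : GenFun Ω) : evalAt hx (diffOp Ω hm a u) ∈ Ideal.span (range a) := by
  rw [diffOp, map_sum]
  refine Ideal.sum_mem _ fun k _ => ?_
  rw [evalAt_smul]
  exact Ideal.mul_mem_right _ _ (Ideal.subset_span (mem_range_self k))

theorem evalAt_ofHolomorphic (hx : x ∈ Ω) {f : EuclideanSpace ℂ (Fin n) → ℂ}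
    (hf : DifferentiableOn ℂ f Ω) :
    evalAt hx (ofHolomorphic Ω f hf) = GenNum.mk (constNum (f x)) := rfl

end pointValues

end ColombeauFull

theorem mainTheorem7 {n m : ℕ} (hm : m ≤ n)
    (Ω : TopologicalSpace.Opens (EuclideanSpace ℂ (Fin n)))
    (hΩ : IsConnected (Ω : Set (EuclideanSpace ℂ (Fin n))))
    (f : EuclideanSpace ℂ (Fin n) → ℂ) (hf : DifferentiableOn ℂ f Ω)
    (hfnc : ¬ ∃ c : ℂ, ∀ z ∈ Ω, f z = c)
    (a : Fin m → ColombeauFull.GenNum)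
    (hu : ∃ u : ColombeauFull.GenFun Ω,
      ColombeauFull.diffOp Ω hm a u = ColombeauFull.ofHolomorphic Ω f hf) :
    Ideal.span (Set.range a) = ⊤ := by
  obtain ⟨u, hu⟩ := hu
  obtain ⟨z, hz, hfz⟩ : ∃ z ∈ Ω, f z ≠ 0 := by
    by_contra! h
    exact hfnc ⟨0, h⟩
  have hmem := ColombeauFull.evalAt_diffOp_mem_span hz hm a u
  rw [hu, ColombeauFull.evalAt_ofHolomorphic hz hf] at hmem
  exact Ideal.eq_top_of_isUnit_mem _ hmem
    (((isUnit_iff_ne_zero.2 hfz).map ColombeauFull.constNum).map ColombeauFull.GenNum.mk)
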